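/- Let $k$ be a field of characteristic $0$. Let $GT(k)$ be the $k$-prounipotent Grothendieck–Teichmüller group: the group of pairs $(\lambda,f)$ with $\lambda\in k^\times$ and $f\in\mathcal H(k)=\exp\mathcal L(k)$, where $\mathcal L(k)$ is the set of formal Lie series in two variables $x,y$ inside $k\langle\langle x,y\rangle\rangle$, such that 1. $f(u,v)=f(v,u)^{-1}$ for all $u,v\in\mathcal H(k)$; 2. $f(w,u)\,w^m f(v,w)\,v^m f(u,v)\,u^m=1$ with $m=(\lambda-1)/2$, for all $u,v,w\in\mathcal H(k)$ with $uvw=1$; 3. in the $k$-prounipotent completion of the pure braid group $P_4$, $$f(\xi_{12},\xi_{23}\xi_{24})\,f(\xi_{13}\xi_{23},\xi_{34})=f(\xi_{23},\xi_{34})\,f(\xi_{12}\xi_{13},\xi_{24}\xi_{34})\,f(\xi_{12},\xi_{23}),$$ where $\xi_{ij}=\sigma_{j-1}\cdots\sigma_{i+1}\sigma_i^2\sigma_{i+1}^{-1}\cdots\sigma_{j-1}^{-1}$ and $\sigma_1,\sigma_2,\sigma_3$ are the Artin generators of the braid group $B_4$. Here $f(u,v)$ denotes the value of the series $f$ at $x=\log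 u$, $y=\log v$, and $u^c=\exp(c\log u)$. The group law is $(\lambda_1,f_1)(\lambda_2,f_2)=(\lambda_1\lambda_2,f)$ with $f(u,v)=f_1\bigl(f_2(u,v)u^{\lambda_2}f_2(u,v)^{-1},v^{\lambda_2}\bigr)f_2(u,v)$. Let $GT_1(k)$ be the kernel of the projection $GT(k)\to k^\times$, $(\lambda,f)\mapsto\lambda$. Let $k^\times$ act on the multiplicative group $A_1=1+h\,k[[h]]$ by $(a\cdot\alpha)(h)=a(\alpha h)$, and let $GT(k)$ act on $A_1$ on the right through its projection to $k^\times$. Let $H^1(GT(k),A_1)$ be the group of $1$-cocycles $c:GT(k)\to A_1$, $c(g_1g_2)=(c(g_1)\cdot g_2)\,c(g_2)$, modulo the coboundaries $g\mapsto (a\cdot g)\,a^{-1}$, $a\in A_1$; no continuity is imposed. As $GT_1(k)$ acts trivially on $A_1$, restricting cocycles to $GT_1(k)$ defines a homomorphism $$H^1(GT(k),A_1)\longrightarrow \mathrm{Hom}(GT_1(k),A_1).$$ Then this restriction homomorphism is injective. Moreover, for every integer $m\ge 1$, one has $H^1(k^\times,k_m)=0$, where $k_m$ is the additive group of $k$ on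 which $\alpha\in k^\times$ acts by $x\mapsto\alpha^m x$. -/

import Mathlib

noncomputable section

namespace GrothendieckTeichmuller

universe u v

section Completion

variable {k : Type u} [Field k] {B : Type v} [Ring B] [Algebra k B]

/-- The quotient `B / I ^ N`, where `I = ker ε` is the augmentation ideal. -/
abbrev Level (ε : B →ₐ[k] k) (N : ℕ) : Type v := B ⧸ (RingHom.ker ε) ^ N

/-- The transition map `B / I ^ (N + 1) → B / I ^ N`. -/
def transition (ε : B →ₐ[k] k) (N : ℕ) : Level ε (N + 1) →ₐ[k] Level ε N :=
  Ideal.Quotient.factorₐ k (Ideal.pow_le_pow_right (Nat.le_succ N))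

/-- The completion of the augmented algebra `(B, ε)` for the powers of its augmentation ideal
`I = ker ε`: the projective limit of the `B / I ^ N`. -/
def Compl (ε : B →ₐ[k] k) : Subalgebra k (∀ N, Level ε N) where
  carrier := {z | ∀ N, transition ε N (z (N + 1)) = z N}
  mul_mem' ha hb N := by simp [ha N, hb N]
  add_mem' ha hb N := by simp [ha N, hb N]
  algebraMap_mem' r N := by simp

/-- The canonical map from an augmented algebra to its completion. -/
def toCompl (ε : B →ₐ[k] k) : B →ₐ[k] Compl ε :=
  (AlgHom.pi fun N => Ideal.Quotient.mkₐ k ((RingHom.ker ε) ^ N)).codRestrict (Compl ε)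
    fun _ _ => rfl

/-- The projection of the completion to `B / I ^ N`. -/
def proj (ε : B →ₐ[k] k) (N : ℕ) : Compl ε →ₐ[k] Level ε N :=
  (Pi.evalAlgHom k (Level ε) N).comp (Compl ε).val

lemma compl_ext {ε : B →ₐ[k] k} {z w : Compl ε} (h : ∀ N, proj ε N z = proj ε N w) : z = w :=
  Subtype.ext (funext h)

lemma transition_proj (ε : B →ₐ[k] k) (N : ℕ) (z : Compl ε) :
    transition ε N (proj ε (N + 1) z) = proj ε N z := z.2 N

lemma proj_toCompl (ε : B →ₐ[k] k) (N : ℕ) (b : B) :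
    proj ε N (toCompl ε b) = Ideal.Quotient.mk _ b := rfl

lemma transition_mk (ε : B →ₐ[k] k) (N : ℕ) (b : B) :
    transition ε N (Ideal.Quotient.mk _ b) = Ideal.Quotient.mk _ b := rfl

/-- The augmentation (constant term) of an element of the completion. -/
def constTerm (ε : B →ₐ[k] k) : Compl ε →ₐ[k] k :=
  (Ideal.Quotient.liftₐ ((RingHom.ker ε) ^ 1) ε fun a ha => by
    rwa [Submodule.pow_one, RingHom.mem_ker] at ha).comp (proj ε 1)

lemma constTerm_eq (ε : B →ₐ[k] k) (N : ℕ) (z : Compl ε) (b : B)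
    (h : proj ε (N + 1) z = Ideal.Quotient.mk _ b) : constTerm ε z = ε b := by
  induction N with
  | zero =>
    simp only [constTerm, AlgHom.comp_apply]
    rw [h]; rfl
  | succ N ih =>
    apply ih
    rw [← transition_proj, h, transition_mk]

lemma constTerm_toCompl (ε : B →ₐ[k] k) (b : B) : constTerm ε (toCompl ε b) = ε b :=
  constTerm_eq ε 0 _ b rfl

/-- The elements of the completion with zero constant term. -/
def Aug (ε : B →ₐ[k] k) : Submodule k (Compl ε) := LinearMap.ker (constTerm ε).toLinearMap

lemma mem_Aug {ε : B →ₐ[k] k} {z : Compl ε} : z ∈ Aug ε ↔ constTerm ε z = 0 := Iff.rfl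

/-- The group of invertible elements of the completion with constant term `1`. -/
def OneUnits (ε : B →ₐ[k] k) : Subgroup (Compl ε)ˣ :=
  (Units.map (constTerm ε : Compl ε →* k)).ker

lemma mem_OneUnits {ε : B →ₐ[k] k} {z : (Compl ε)ˣ} :
    z ∈ OneUnits ε ↔ constTerm ε (z : Compl ε) = 1 := by
  simp [OneUnits, MonoidHom.mem_ker, Units.ext_iff]

lemma exists_lift {ε : B →ₐ[k] k} {z : Compl ε} (hz : z ∈ Aug ε) (N : ℕ) :
    ∃ b, ε b = 0 ∧ proj ε N z = Ideal.Quotient.mk _ b := by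
  cases N with
  | zero =>
    refine ⟨0, map_zero _, ?_⟩
    obtain ⟨b, hb⟩ := Ideal.Quotient.mk_surjective (proj ε 0 z)
    rw [← hb, Ideal.Quotient.eq]
    simp [Submodule.pow_zero, Ideal.one_eq_top]
  | succ N =>
    obtain ⟨b, hb⟩ := Ideal.Quotient.mk_surjective (proj ε (N + 1) z)
    exact ⟨b, (constTerm_eq ε N z b hb.symm).symm.trans hz, hb.symm⟩

lemma pow_mem_ker_pow (ε : B →ₐ[k] k) {b : B} (hb : ε b = 0) (N : ℕ) :
    b ^ N ∈ (RingHom.ker ε) ^ N := Ideal.pow_mem_pow hb N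

lemma proj_pow_eq_zero {ε : B →ₐ[k] k} {z : Compl ε} (hz : z ∈ Aug ε) {N n : ℕ} (h : N ≤ n) :
    proj ε N z ^ n = 0 := by
  obtain ⟨b, hb, e⟩ := exists_lift hz N
  rw [e, ← map_pow, Ideal.Quotient.eq_zero_iff_mem]
  exact Ideal.pow_le_pow_right h (pow_mem_ker_pow ε hb n)

/-- The value `∑ n, pₙ aⁿ` of a one variable power series `p` at an element `a` with zero
constant term; modulo `I ^ N` the terms with `n ≥ N` vanish. -/
def seriesEval {ε : B →ₐ[k] k} (p : PowerSeries k) (a : Aug ε) : Compl ε :=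
  ⟨fun N => ∑ n ∈ Finset.range N, PowerSeries.coeff n p • proj ε N a ^ n, fun N => by
    beta_reduce
    rw [Finset.sum_range_succ, map_add, map_sum]
    simp only [map_smul, map_pow, transition_proj]
    rw [proj_pow_eq_zero a.2 le_rfl, smul_zero, add_zero]⟩

lemma constTerm_seriesEval {ε : B →ₐ[k] k} (p : PowerSeries k) (a : Aug ε) :
    constTerm ε (seriesEval p a) = PowerSeries.coeff 0 p := by
  have h : proj ε 1 (seriesEval p a) =
      Ideal.Quotient.mk _ (algebraMap k B (PowerSeries.coeff 0 p)) := by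
    change ∑ n ∈ Finset.range 1, PowerSeries.coeff n p • proj ε 1 (a : Compl ε) ^ n = _
    simp [Algebra.smul_def]
  rw [constTerm_eq ε 0 _ _ h, AlgHom.commutes]; rfl

variable [CharZero k]

/-- `exp a = ∑ aⁿ / n!`. -/
def cexp {ε : B →ₐ[k] k} (a : Aug ε) : Compl ε := seriesEval (PowerSeries.exp k) a

/-- `log u = ∑_{n ≥ 1} (-1)ⁿ⁺¹ (u - 1)ⁿ / n`. -/
def clog {ε : B →ₐ[k] k} (u : OneUnits ε) : Aug ε :=
  ⟨seriesEval (PowerSeries.log k) ⟨((u : (Compl ε)ˣ) : Compl ε) - 1, by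
      rw [mem_Aug, map_sub, mem_OneUnits.1 u.2, map_one, sub_self]⟩, by
    rw [mem_Aug, constTerm_seriesEval]; simp⟩

/-- `u ^ c = exp (c log u)` for a scalar `c`. -/
def cpow {ε : B →ₐ[k] k} (u : OneUnits ε) (c : k) : Compl ε := cexp (c • clog u)

end Completion

section Substitution

/-- The free associative algebra `k⟨x, y⟩`. -/
abbrev Free₂ (k : Type u) [Field k] : Type u := FreeAlgebra k (Fin 2)

variable (k : Type u) [Field k]

/-- The augmentation of `k⟨x, y⟩`, which sends `x` and `y` to `0`. -/
def augFree : Free₂ k →ₐ[k] k := FreeAlgebra.lift k fun _ => 0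

/-- The algebra `k⟪x, y⟫` of formal power series in two noncommuting variables. -/
abbrev NCSeries : Type u := Compl (augFree k)

lemma toCompl_ι_mem (i : Fin 2) : toCompl (augFree k) (FreeAlgebra.ι k i) ∈ Aug (augFree k) := by
  rw [mem_Aug, constTerm_toCompl]; simp [augFree]

/-- The variable `x`. -/
def X : Aug (augFree k) := ⟨_, toCompl_ι_mem k 0⟩

/-- The variable `y`. -/
def Y : Aug (augFree k) := ⟨_, toCompl_ι_mem k 1⟩

variable {k} {B : Type v} [Ring B] [Algebra k B]

lemma ker_pow_le {C : Type*} [Ring C] [Algebra k C] (ε : B →ₐ[k] k) (η : C →ₐ[k] k)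
    (ψ : C →ₐ[k] B) (h : ε.comp ψ = η) (N : ℕ) {c : C} (hc : c ∈ (RingHom.ker η) ^ N) :
    ψ c ∈ (RingHom.ker ε) ^ N := by
  induction N generalizing c with
  | zero => simp [Submodule.pow_zero, Ideal.one_eq_top]
  | succ N ih =>
    rw [Ideal.IsTwoSided.pow_succ] at hc ⊢
    refine Submodule.mul_induction_on hc (fun m hm n hn => ?_) (fun p q hp hq => ?_)
    · rw [map_mul]
      refine Ideal.mul_mem_mul ?_ (ih hn)
      rw [RingHom.mem_ker] at hm ⊢
      rw [← hm, ← h]; rfl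
    · rw [map_add]; exact add_mem hp hq

lemma exists_freeLift {ε : B →ₐ[k] k} (a b : Aug ε) (N : ℕ) :
    ∃ ψ : Free₂ k →ₐ[k] B, ε.comp ψ = augFree k ∧
      (Ideal.Quotient.mkₐ k ((RingHom.ker ε) ^ N)).comp ψ =
        FreeAlgebra.lift k ![proj ε N a, proj ε N b] := by
  obtain ⟨α, hα, hα'⟩ := exists_lift a.2 N
  obtain ⟨β, hβ, hβ'⟩ := exists_lift b.2 N
  refine ⟨FreeAlgebra.lift k ![α, β], ?_, ?_⟩
  · ext i; fin_cases i <;> simp [augFree, hα, hβ]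
  · ext i; fin_cases i <;> simp [hα', hβ']

/-- Substitution modulo `I ^ N`. -/
def substLevel {ε : B →ₐ[k] k} (a b : Aug ε) (N : ℕ) : Level (augFree k) N →ₐ[k] Level ε N :=
  Ideal.Quotient.liftₐ _ (FreeAlgebra.lift k ![proj ε N a, proj ε N b]) fun c hc => by
    obtain ⟨ψ, h, e⟩ := exists_freeLift a b N
    rw [← e]
    exact Ideal.Quotient.eq_zero_iff_mem.2 (ker_pow_le ε _ ψ h N hc)

lemma transition_substLevel {ε : B →ₐ[k] k} (a b : Aug ε) (N : ℕ) :
    (transition ε N).comp (substLevel a b (N + 1)) =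
      (substLevel a b N).comp (transition (augFree k) N) := by
  apply Ideal.Quotient.algHom_ext
  ext i
  change transition ε N (FreeAlgebra.lift k _ (FreeAlgebra.ι k i)) =
    FreeAlgebra.lift k _ (FreeAlgebra.ι k i)
  fin_cases i <;> simp [transition_proj]

/-- The substitution `f(x, y) ↦ f(a, b)` for `a`, `b` with zero constant term, in the completion
of any augmented algebra: the continuous algebra map with `x ↦ a` and `y ↦ b`. -/
def subst {ε : B →ₐ[k] k} (a b : Aug ε) : NCSeries k →ₐ[k] Compl ε :=
  (AlgHom.pi fun N => (substLevel a b N).comp (proj (augFree k) N)).codRestrict (Compl ε)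
    fun z N => by
      have := DFunLike.congr_fun (transition_substLevel a b N) (proj _ (N + 1) z)
      simpa [transition_proj] using this

lemma proj_subst {ε : B →ₐ[k] k} (a b : Aug ε) (N : ℕ) (z : NCSeries k) :
    proj ε N (subst a b z) = substLevel a b N (proj (augFree k) N z) := rfl

lemma subst_X {ε : B →ₐ[k] k} (a b : Aug ε) : subst a b (X k) = a :=
  compl_ext fun N => by
    change FreeAlgebra.lift k _ (FreeAlgebra.ι k 0) = _
    simp

lemma subst_Y {ε : B →ₐ[k] k} (a b : Aug ε) : subst a b (Y k) = b :=
  compl_ext fun N => by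
    change FreeAlgebra.lift k _ (FreeAlgebra.ι k 1) = _
    simp

lemma constTerm_subst {ε : B →ₐ[k] k} (a b : Aug ε) (z : NCSeries k) :
    constTerm ε (subst a b z) = constTerm (augFree k) z := by
  obtain ⟨c, hc⟩ := Ideal.Quotient.mk_surjective (proj (augFree k) 1 z)
  obtain ⟨ψ, h, e⟩ := exists_freeLift a b 1
  rw [constTerm_eq _ 0 z c hc.symm, constTerm_eq ε 0 (subst a b z) (ψ c), ← h]; rfl
  rw [proj_subst, ← hc]
  exact (DFunLike.congr_fun e c).symm

/-- Substitution `f ↦ f(a, b)` on series with constant term `1`. -/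
def substUnit {ε : B →ₐ[k] k} (a b : Aug ε) : OneUnits (augFree k) →* OneUnits ε :=
  ((Units.map (subst a b : NCSeries k →* Compl ε)).comp (OneUnits (augFree k)).subtype).codRestrict
    (OneUnits ε) fun f => by
      rw [mem_OneUnits]
      exact (constTerm_subst a b _).trans (mem_OneUnits.1 f.2)

/-- `f(u, v) = f(log u, log v)`, where on the right `log u` and `log v` are substituted for
`x` and `y`. -/
def groupEval [CharZero k] {ε : B →ₐ[k] k} (f : OneUnits (augFree k)) (u v : OneUnits ε) :
    OneUnits ε := substUnit (clog u) (clog v) f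

end Substitution

section AmbientGroup

variable {k : Type u} [Field k]

lemma subst_mem_Aug {B : Type v} [Ring B] [Algebra k B] {ε : B →ₐ[k] k} (a b : Aug ε)
    {z : NCSeries k} (hz : z ∈ Aug (augFree k)) : subst a b z ∈ Aug ε :=
  (constTerm_subst a b z).trans hz

lemma subst_subst {B : Type v} [Ring B] [Algebra k B] {ε : B →ₐ[k] k} (c d : Aug ε)
    (a b : Aug (augFree k)) (z : NCSeries k) :
    subst c d (subst a b z) =
      subst ⟨subst c d a, subst_mem_Aug c d a.2⟩ ⟨subst c d b, subst_mem_Aug c d b.2⟩ z := by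
  refine compl_ext fun N => ?_
  simp only [proj_subst]
  suffices h : (substLevel c d N).comp (substLevel a b N) =
      substLevel ⟨subst c d a, subst_mem_Aug c d a.2⟩ ⟨subst c d b, subst_mem_Aug c d b.2⟩ N from
    DFunLike.congr_fun h _
  apply Ideal.Quotient.algHom_ext
  ext i
  change substLevel c d N (FreeAlgebra.lift k _ (FreeAlgebra.ι k i)) =
    FreeAlgebra.lift k _ (FreeAlgebra.ι k i)
  fin_cases i <;> simp [proj_subst]

lemma subst_X_Y (z : NCSeries k) : subst (X k) (Y k) z = z := by
  refine compl_ext fun N => ?_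
  simp only [proj_subst]
  suffices h : substLevel (X k) (Y k) N = AlgHom.id k _ from DFunLike.congr_fun h _
  apply Ideal.Quotient.algHom_ext
  ext i
  change FreeAlgebra.lift k _ (FreeAlgebra.ι k i) = Ideal.Quotient.mk _ (FreeAlgebra.ι k i)
  fin_cases i <;> simp <;> rfl

variable (k) in
/-- The pairs `(λ, f)` of an invertible scalar `λ` and a series `f` with constant term `1`. -/
@[ext]
structure Pair where
  /-- The scalar `λ`. -/
  scal : kˣ
  /-- The series `f`. -/
  ser : OneUnits (augFree k)

/-- The element `λ f x f⁻¹`, which is the logarithm of `f e^{λ x} f⁻¹`. -/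
def conjX (g : Pair k) : Aug (augFree k) :=
  ⟨(g.scal : k) • ((g.ser : (NCSeries k)ˣ) * (X k : NCSeries k) *
      ((g.ser⁻¹ : OneUnits (augFree k)) : (NCSeries k)ˣ)), by
    have : constTerm (augFree k) (X k) = 0 := (X k).2
    rw [mem_Aug, map_smul, map_mul, map_mul, this, mul_zero, zero_mul, smul_zero]⟩

/-- The element `λ y`, which is the logarithm of `e^{λ y}`. -/
def scaleY (g : Pair k) : Aug (augFree k) := (g.scal : k) • Y k

/-- For `(λ, f)`, the substitution `h(x, y) ↦ h(λ f x f⁻¹, λ y)`; in terms of `u = e^x` and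
`v = e^y` it is `h(u, v) ↦ h(f(u, v) u^λ f(u, v)⁻¹, v^λ)`. -/
def act (g : Pair k) : OneUnits (augFree k) →* OneUnits (augFree k) :=
  substUnit (conjX g) (scaleY g)

/-- The law `(λ₁, f₁) (λ₂, f₂) = (λ₁ λ₂, f)` with
`f(u, v) = f₁(f₂(u, v) u^λ₂ f₂(u, v)⁻¹, v^λ₂) f₂(u, v)`. -/
instance : Mul (Pair k) := ⟨fun g₁ g₂ => ⟨g₁.scal * g₂.scal, act g₂ g₁.ser * g₂.ser⟩⟩

instance : One (Pair k) := ⟨⟨1, 1⟩⟩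

lemma val_act (g : Pair k) (f : OneUnits (augFree k)) :
    ((act g f : (NCSeries k)ˣ) : NCSeries k) =
      subst (conjX g) (scaleY g) ((f : (NCSeries k)ˣ) : NCSeries k) := rfl

lemma conjX_coe (g : Pair k) : (conjX g : NCSeries k) =
    (g.scal : k) • ((g.ser : (NCSeries k)ˣ) * (X k : NCSeries k) *
      ((g.ser⁻¹ : OneUnits (augFree k)) : (NCSeries k)ˣ)) := rfl

lemma oneUnits_ext {f h : OneUnits (augFree k)}
    (e : ((f : (NCSeries k)ˣ) : NCSeries k) = ((h : (NCSeries k)ˣ) : NCSeries k)) : f = h :=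
  Subtype.ext (Units.ext e)

lemma conj_aux {R : Type*} [Ring R] [Algebra k R] (a b : k) (p p' q q' x : R) :
    a • (p * (b • (q * x * q')) * p') = (a * b) • (p * q * x * (q' * p')) := by
  simp only [mul_smul_comm, smul_mul_assoc, smul_smul, mul_assoc]

lemma coe_conjX_mul (g₁ g₂ : Pair k) : (conjX (g₁ * g₂) : NCSeries k) =
    ((g₁.scal : k) * (g₂.scal : k)) •
      (((act g₂ g₁.ser : (NCSeries k)ˣ) : NCSeries k) * ((g₂.ser : (NCSeries k)ˣ) : NCSeries k) *
        (X k : NCSeries k) * (((g₂.ser⁻¹ : OneUnits (augFree k)) : (NCSeries k)ˣ) *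
        (((act g₂ g₁.ser)⁻¹ : OneUnits (augFree k)) : (NCSeries k)ˣ))) := by
  have h : (g₁ * g₂).ser⁻¹ = g₂.ser⁻¹ * (act g₂ g₁.ser)⁻¹ := mul_inv_rev _ _
  rw [conjX_coe, h]
  rfl

lemma subst_conjX (g₁ g₂ : Pair k) : subst (conjX g₂) (scaleY g₂) (conjX g₁ : NCSeries k) =
    ((g₁.scal : k) * (g₂.scal : k)) •
      (((act g₂ g₁.ser : (NCSeries k)ˣ) : NCSeries k) * ((g₂.ser : (NCSeries k)ˣ) : NCSeries k) *
        (X k : NCSeries k) * (((g₂.ser⁻¹ : OneUnits (augFree k)) : (NCSeries k)ˣ) *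
        (((act g₂ g₁.ser)⁻¹ : OneUnits (augFree k)) : (NCSeries k)ˣ))) := by
  have h : subst (conjX g₂) (scaleY g₂) (((g₁.ser⁻¹ : OneUnits (augFree k)) : (NCSeries k)ˣ)) =
      (((act g₂ g₁.ser)⁻¹ : OneUnits (augFree k)) : (NCSeries k)ˣ) := by
    rw [← map_inv, val_act]
  rw [← conj_aux, ← h, val_act, ← conjX_coe g₂, ← subst_X (conjX g₂) (scaleY g₂), ← map_mul,
    ← map_mul, ← map_smul, conjX_coe g₁]

lemma act_mul (g₁ g₂ : Pair k) (f : OneUnits (augFree k)) :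
    act (g₁ * g₂) f = act g₂ (act g₁ f) := by
  apply oneUnits_ext
  simp only [val_act]
  rw [subst_subst]
  congr 2
  · apply Subtype.ext
    exact (coe_conjX_mul g₁ g₂).trans (subst_conjX g₁ g₂).symm
  · apply Subtype.ext
    change _ = subst (conjX g₂) (scaleY g₂) (scaleY g₁ : NCSeries k)
    change ((g₁.scal * g₂.scal : kˣ) : k) • (Y k : NCSeries k) =
      subst (conjX g₂) (scaleY g₂) ((g₁.scal : k) • (Y k : NCSeries k))
    rw [map_smul, subst_Y, Units.val_mul, mul_smul]
    rfl

lemma act_one (f : OneUnits (augFree k)) : act 1 f = f := by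
  apply oneUnits_ext
  rw [val_act]
  have h₁ : conjX (1 : Pair k) = X k := by
    apply Subtype.ext
    change ((1 : kˣ) : k) • (((1 : OneUnits (augFree k)) : (NCSeries k)ˣ) * (X k : NCSeries k) *
      (((1 : OneUnits (augFree k))⁻¹ : OneUnits (augFree k)) : (NCSeries k)ˣ)) = _
    simp
  have h₂ : scaleY (1 : Pair k) = Y k := one_smul k _
  rw [h₁, h₂, subst_X_Y]

lemma leadingTerm {ψ : Free₂ k →ₐ[k] Free₂ k} {c : k} (h : (augFree k).comp ψ = augFree k)
    (h₂ : ∀ i, ψ (FreeAlgebra.ι k i) - c • FreeAlgebra.ι k i ∈ RingHom.ker (augFree k) ^ 2)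
    (n : ℕ) {z : Free₂ k} (hz : z ∈ RingHom.ker (augFree k) ^ n) :
    ψ z - c ^ n • z ∈ RingHom.ker (augFree k) ^ (n + 1) := by
  have hε (w : Free₂ k) : augFree k (ψ w) = augFree k w := DFunLike.congr_fun h w
  have smul_mem {n : ℕ} {w : Free₂ k} (r : k) (hw : w ∈ RingHom.ker (augFree k) ^ n) :
      r • w ∈ RingHom.ker (augFree k) ^ n := by
    rw [Algebra.smul_def]; exact Ideal.mul_mem_left _ _ hw
  have key (w : Free₂ k) : ψ w - c • w - ((1 - c) * augFree k w) • 1 ∈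
      RingHom.ker (augFree k) ^ 2 := by
    induction w using FreeAlgebra.induction with
    | grade0 r =>
      have : ψ (algebraMap k _ r) - c • algebraMap k _ r -
          ((1 - c) * augFree k (algebraMap k _ r)) • (1 : Free₂ k) = 0 := by
        rw [AlgHom.commutes, AlgHom.commutes, Algebra.algebraMap_eq_smul_one]
        simp only [Algebra.algebraMap_self, RingHom.id_apply, smul_smul, ← sub_smul]
        ring_nf; simp
      rw [this]; exact zero_mem _
    | grade1 i => simpa [augFree] using h₂ i
    | add a b ha hb =>
      convert add_mem ha hb using 1
      simp only [map_add, smul_add, mul_add, add_smul]; abel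
    | mul a b ha hb =>
      have hab : (a - augFree k a • 1) * (b - augFree k b • 1) ∈ RingHom.ker (augFree k) ^ 2 := by
        rw [Ideal.IsTwoSided.pow_succ, Submodule.pow_one]
        refine Ideal.mul_mem_mul ?_ ?_ <;> simp [RingHom.mem_ker]
      have e : ψ (a * b) - c • (a * b) - ((1 - c) * augFree k (a * b)) • 1 =
          (ψ a - c • a - ((1 - c) * augFree k a) • 1) * ψ b +
          (c • a + ((1 - c) * augFree k a) • 1) * (ψ b - c • b - ((1 - c) * augFree k b) • 1) -
          (c * (1 - c)) • ((a - augFree k a • 1) * (b - augFree k b • 1)) := by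
        simp only [map_mul, mul_sub, sub_mul, add_mul, mul_smul_comm, smul_mul_assoc,
          mul_one, one_mul, smul_sub, smul_smul]
        module
      rw [e]
      exact sub_mem (add_mem (Ideal.mul_mem_right _ _ ha) (Ideal.mul_mem_left _ _ hb))
        (smul_mem _ hab)
  induction n generalizing z with
  | zero =>
    rw [Submodule.pow_one, RingHom.mem_ker]
    simp [hε]
  | succ n ih =>
    rw [Ideal.IsTwoSided.pow_succ] at hz
    refine Submodule.mul_induction_on hz (fun p hp q hq => ?_) (fun p q hp hq => ?_)
    · have e : ψ (p * q) - c ^ (n + 1) • (p * q) =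
          (ψ p - c • p) * ψ q + c • (p * (ψ q - c ^ n • q)) := by
        simp only [map_mul, sub_mul, mul_sub, mul_smul_comm, smul_mul_assoc, smul_sub, smul_smul]
        rw [pow_succ, mul_comm]; abel
      rw [e]
      have hp2 : ψ p - c • p ∈ RingHom.ker (augFree k) ^ 2 := by
        have := key p
        rw [RingHom.mem_ker] at hp
        simpa [hp] using this
      refine add_mem ?_ (smul_mem _ ?_)
      · rw [show n + 1 + 1 = 2 + n by ring, Ideal.IsTwoSided.pow_add]
        exact Ideal.mul_mem_mul hp2 (ker_pow_le _ _ ψ h n hq)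
      · rw [Ideal.IsTwoSided.pow_succ]
        exact Ideal.mul_mem_mul hp (ih hq)
    · convert add_mem hp hq using 1
      simp only [map_add, smul_add]; abel

lemma exists_actLift (g : Pair k) (N : ℕ) : ∃ ψ : Free₂ k →ₐ[k] Free₂ k,
    (augFree k).comp ψ = augFree k ∧
    (∀ i, ψ (FreeAlgebra.ι k i) - (g.scal : k) • FreeAlgebra.ι k i ∈
      RingHom.ker (augFree k) ^ 2) ∧
    ∀ z, substLevel (conjX g) (scaleY g) N (Ideal.Quotient.mk _ z) =
      Ideal.Quotient.mk _ (ψ z) := by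
  have lift_one (f : OneUnits (augFree k)) : ∃ b : Free₂ k, augFree k b = 0 ∧
      proj (augFree k) N ((f : (NCSeries k)ˣ) : NCSeries k) = Ideal.Quotient.mk _ (1 + b) := by
    have : ((f : (NCSeries k)ˣ) : NCSeries k) - 1 ∈ Aug (augFree k) := by
      rw [mem_Aug, map_sub, mem_OneUnits.1 f.2, map_one, sub_self]
    obtain ⟨b, hb, e⟩ := exists_lift this N
    refine ⟨b, hb, ?_⟩
    rw [map_add, ← e, map_sub, map_one, map_one]; abel
  obtain ⟨p, hp, ep⟩ := lift_one g.ser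
  obtain ⟨q, hq, eq⟩ := lift_one g.ser⁻¹
  set x : Free₂ k := FreeAlgebra.ι k 0 with hx
  set y : Free₂ k := FreeAlgebra.ι k 1 with hy
  have εx : augFree k x = 0 := by simp [x, augFree]
  have εy : augFree k y = 0 := by simp [y, augFree]
  have mem2 {a b : Free₂ k} (ha : augFree k a = 0) (hb : augFree k b = 0) :
      a * b ∈ RingHom.ker (augFree k) ^ 2 := by
    rw [Ideal.IsTwoSided.pow_succ, Submodule.pow_one]
    exact Ideal.mul_mem_mul ha hb
  refine ⟨FreeAlgebra.lift k ![(g.scal : k) • ((1 + p) * x * (1 + q)), (g.scal : k) • y],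
    ?_, fun i => ?_, ?_⟩
  · ext i; fin_cases i
    · simp [εx]; simp [augFree]
    · simp [εy]; simp [augFree]
  · fin_cases i
    · have e : (g.scal : k) • ((1 + p) * x * (1 + q)) - (g.scal : k) • x =
          algebraMap k _ (g.scal : k) * (p * x + (1 + p) * (x * q)) := by
        rw [← smul_sub, Algebra.smul_def]
        congr 1
        noncomm_ring
      simp only [FreeAlgebra.lift_ι_apply, Fin.zero_eta, Matrix.cons_val_zero]
      rw [e]
      exact Ideal.mul_mem_left _ _ (add_mem (mem2 hp εx) (Ideal.mul_mem_left _ _ (mem2 εx hq)))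
    · simp [y]
  · intro z
    suffices h : (substLevel (conjX g) (scaleY g) N).comp (Ideal.Quotient.mkₐ k _) =
      (Ideal.Quotient.mkₐ k _).comp (FreeAlgebra.lift k
        ![(g.scal : k) • ((1 + p) * x * (1 + q)), (g.scal : k) • y]) from
      DFunLike.congr_fun h z
    ext i
    change FreeAlgebra.lift k _ (FreeAlgebra.ι k i) =
      Ideal.Quotient.mkₐ k _ (FreeAlgebra.lift k _ (FreeAlgebra.ι k i))
    fin_cases i
    · simp only [FreeAlgebra.lift_ι_apply, Fin.zero_eta, Matrix.cons_val_zero, conjX, map_smul,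
        map_mul, ep, eq]
      rfl
    · simp only [FreeAlgebra.lift_ι_apply, Fin.mk_one, Matrix.cons_val_one, Matrix.cons_val_zero,
        map_smul]
      exact map_smul (proj (augFree k) N) _ _

lemma substLevel_bijective (g : Pair k) (N : ℕ) :
    Function.Bijective (substLevel (conjX g) (scaleY g) N) := by
  obtain ⟨ψ, h, h₂, e⟩ := exists_actLift g N
  have hne (n : ℕ) : (g.scal : k) ^ n ≠ 0 := pow_ne_zero _ g.scal.ne_zero
  constructor
  · rw [injective_iff_map_eq_zero]
    intro z hz
    have (n : ℕ) : ∃ c ∈ RingHom.ker (augFree k) ^ n, Ideal.Quotient.mk _ c = z := by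
      induction n with
      | zero =>
        obtain ⟨c, rfl⟩ := Ideal.Quotient.mk_surjective z
        exact ⟨c, by simp [Submodule.pow_zero, Ideal.one_eq_top], rfl⟩
      | succ n ih =>
        obtain ⟨c, hc, rfl⟩ := ih
        have hl := leadingTerm h h₂ n hc
        refine ⟨-((g.scal : k) ^ n)⁻¹ • (ψ c - (g.scal : k) ^ n • c), ?_, ?_⟩
        · rw [Algebra.smul_def]; exact Ideal.mul_mem_left _ _ hl
        · rw [e] at hz
          rw [smul_sub, smul_smul, neg_mul, inv_mul_cancel₀ (hne n), neg_smul, neg_smul, one_smul,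
            sub_neg_eq_add, map_add, map_neg]
          change -(Ideal.Quotient.mkₐ k _ (((g.scal : k) ^ n)⁻¹ • ψ c)) + _ = _
          rw [map_smul]
          change -(((g.scal : k) ^ n)⁻¹ • Ideal.Quotient.mk _ (ψ c)) + _ = _
          rw [hz, smul_zero, neg_zero, zero_add]
    obtain ⟨c, hc, rfl⟩ := this N
    exact Ideal.Quotient.eq_zero_iff_mem.2 hc
  · have (j : ℕ) : ∀ n, N ≤ n + j → ∀ c ∈ RingHom.ker (augFree k) ^ n,
        ∃ w, substLevel (conjX g) (scaleY g) N w = Ideal.Quotient.mk _ c := by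
      induction j with
      | zero =>
        intro n hn c hc
        refine ⟨0, ?_⟩
        rw [map_zero, eq_comm, Ideal.Quotient.eq_zero_iff_mem]
        exact Ideal.pow_le_pow_right hn hc
      | succ j ih =>
        intro n hn c hc
        have hc' : ((g.scal : k) ^ n)⁻¹ • c ∈ RingHom.ker (augFree k) ^ n := by
          rw [Algebra.smul_def]; exact Ideal.mul_mem_left _ _ hc
        have hl := leadingTerm h h₂ n hc'
        rw [smul_smul, mul_inv_cancel₀ (hne n), one_smul] at hl
        obtain ⟨w, hw⟩ := ih (n + 1) (by omega) _ hl
        refine ⟨Ideal.Quotient.mk _ (((g.scal : k) ^ n)⁻¹ • c) - w, ?_⟩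
        rw [map_sub, hw, e, ← map_sub, sub_sub_cancel]
    intro z
    obtain ⟨c, rfl⟩ := Ideal.Quotient.mk_surjective z
    exact this N 0 (by omega) c (by simp [Submodule.pow_zero, Ideal.one_eq_top])

lemma subst_bijective (g : Pair k) :
    Function.Bijective (subst (conjX g) (scaleY g)) := by
  constructor
  · intro z w e
    refine compl_ext fun N => (substLevel_bijective g N).1 ?_
    rw [← proj_subst, ← proj_subst, e]
  · intro z
    choose w hw using fun N => (substLevel_bijective g N).2 (proj _ N z)
    refine ⟨⟨w, fun N => (substLevel_bijective g N).1 ?_⟩, compl_ext fun N => hw N⟩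
    have := DFunLike.congr_fun (transition_substLevel (conjX g) (scaleY g) N) (w (N + 1))
    simp only [AlgHom.comp_apply] at this
    rw [hw, ← this, hw, transition_proj]

lemma act_surjective (g : Pair k) : Function.Surjective (act g) := by
  intro f
  let E := AlgEquiv.ofBijective _ (subst_bijective g)
  let w : (NCSeries k)ˣ := Units.map (E.symm : NCSeries k →* NCSeries k) (f : (NCSeries k)ˣ)
  have hw : subst (conjX g) (scaleY g) (w : NCSeries k) = ((f : (NCSeries k)ˣ) : NCSeries k) :=
    E.apply_symm_apply _
  refine ⟨⟨w, mem_OneUnits.2 ?_⟩, oneUnits_ext hw⟩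
  rw [← constTerm_subst (conjX g) (scaleY g), hw]
  exact mem_OneUnits.1 f.2

instance : Inv (Pair k) := ⟨fun g => ⟨g.scal⁻¹, (act_surjective g g.ser⁻¹).choose⟩⟩

lemma scal_mul (g₁ g₂ : Pair k) : (g₁ * g₂).scal = g₁.scal * g₂.scal := rfl

lemma ser_mul (g₁ g₂ : Pair k) : (g₁ * g₂).ser = act g₂ g₁.ser * g₂.ser := rfl

lemma scal_one : (1 : Pair k).scal = 1 := rfl

lemma ser_one : (1 : Pair k).ser = 1 := rfl

lemma scal_inv (g : Pair k) : (g⁻¹).scal = g.scal⁻¹ := rfl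

lemma act_ser_inv (g : Pair k) : act g (g⁻¹).ser = g.ser⁻¹ :=
  (act_surjective g g.ser⁻¹).choose_spec

lemma pair_mul_assoc (g₁ g₂ g₃ : Pair k) : g₁ * g₂ * g₃ = g₁ * (g₂ * g₃) := by
  refine Pair.ext (mul_assoc g₁.scal g₂.scal g₃.scal) ?_
  calc (g₁ * g₂ * g₃).ser = act g₃ (act g₂ g₁.ser * g₂.ser) * g₃.ser := rfl
    _ = act g₃ (act g₂ g₁.ser) * act g₃ g₂.ser * g₃.ser := congrArg (· * g₃.ser) (map_mul _ _ _)
    _ = act g₃ (act g₂ g₁.ser) * (act g₃ g₂.ser * g₃.ser) := mul_assoc _ _ _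
    _ = act (g₂ * g₃) g₁.ser * (act g₃ g₂.ser * g₃.ser) :=
      congrArg (· * (act g₃ g₂.ser * g₃.ser)) (act_mul g₂ g₃ g₁.ser).symm
    _ = (g₁ * (g₂ * g₃)).ser := rfl

lemma pair_one_mul (g : Pair k) : 1 * g = g := by
  apply Pair.ext
  · rw [scal_mul, scal_one, one_mul]
  · rw [ser_mul, ser_one, map_one, one_mul]

lemma pair_inv_mul_cancel (g : Pair k) : g⁻¹ * g = 1 := by
  apply Pair.ext
  · rw [scal_mul, scal_inv, inv_mul_cancel, scal_one]
  · rw [ser_mul, act_ser_inv, inv_mul_cancel, ser_one]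

instance : Group (Pair k) :=
  Group.ofLeftAxioms pair_mul_assoc pair_one_mul pair_inv_mul_cancel

end AmbientGroup

section PureBraids

/-- Artin's relations for the braid group on four strands. -/
def braidRels : Set (FreeGroup (Fin 3)) :=
  let s := fun i : Fin 3 => FreeGroup.of i
  {s 0 * s 2 * (s 2 * s 0)⁻¹,
    s 0 * s 1 * s 0 * (s 1 * s 0 * s 1)⁻¹,
    s 1 * s 2 * s 1 * (s 2 * s 1 * s 2)⁻¹}

/-- The braid group `B₄`. -/
abbrev B₄ : Type := PresentedGroup braidRels

/-- The Artin generators `σ₁, σ₂, σ₃` are `σ 0, σ 1, σ 2`. -/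
def σ (i : Fin 3) : B₄ := PresentedGroup.of i

/-- The projection of `B₄` to the symmetric group, which sends `σᵢ` to the transposition
`(i, i + 1)`. -/
def toPerm : B₄ →* Equiv.Perm (Fin 4) :=
  PresentedGroup.toGroup (f := fun i : Fin 3 => Equiv.swap i.castSucc i.succ) (by
    rintro r (rfl | rfl | rfl) <;> simp only [map_mul, map_inv, FreeGroup.lift_apply_of] <;> decide)

/-- The pure braid group `P₄`. -/
abbrev P₄ : Subgroup B₄ := toPerm.ker

lemma toPerm_σ (i : Fin 3) : toPerm (σ i) = Equiv.swap i.castSucc i.succ :=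
  PresentedGroup.toGroup.of _

/-- `ξ₁₂ = σ₁²`. -/
def ξ₁₂ : P₄ := ⟨σ 0 ^ 2, by rw [MonoidHom.mem_ker]; simp only [map_pow, toPerm_σ]; decide⟩

/-- `ξ₂₃ = σ₂²`. -/
def ξ₂₃ : P₄ := ⟨σ 1 ^ 2, by rw [MonoidHom.mem_ker]; simp only [map_pow, toPerm_σ]; decide⟩

/-- `ξ₃₄ = σ₃²`. -/
def ξ₃₄ : P₄ := ⟨σ 2 ^ 2, by rw [MonoidHom.mem_ker]; simp only [map_pow, toPerm_σ]; decide⟩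

/-- `ξ₁₃ = σ₂ σ₁² σ₂⁻¹`. -/
def ξ₁₃ : P₄ := ⟨σ 1 * σ 0 ^ 2 * (σ 1)⁻¹, by
  rw [MonoidHom.mem_ker]; simp only [map_mul, map_inv, map_pow, toPerm_σ]; decide⟩

/-- `ξ₂₄ = σ₃ σ₂² σ₃⁻¹`. -/
def ξ₂₄ : P₄ := ⟨σ 2 * σ 1 ^ 2 * (σ 2)⁻¹, by
  rw [MonoidHom.mem_ker]; simp only [map_mul, map_inv, map_pow, toPerm_σ]; decide⟩

variable (k : Type u) [Field k]

/-- The augmentation of the group algebra `k[P₄]`, which sends every group element to `1`. -/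
def augP₄ : MonoidAlgebra k P₄ →ₐ[k] k := MonoidAlgebra.lift k k P₄ 1

/-- The map from `P₄` to the completion of its group algebra. The `k`-prounipotent completion
`P₄(k)` is the group of grouplike elements of this completion, so that an identity in `P₄(k)` is
an identity between elements of the completed group algebra. -/
def grp : P₄ →* OneUnits (augP₄ k) :=
  (((toCompl (augP₄ k) : MonoidAlgebra k P₄ →* Compl (augP₄ k)).comp
    (MonoidAlgebra.of k P₄)).toHomUnits).codRestrict (OneUnits (augP₄ k)) fun p => by
      rw [mem_OneUnits]
      exact (constTerm_toCompl _ _).trans (by simp [augP₄])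

end PureBraids

section GT

attribute [local instance] LieRing.ofAssociativeRing

variable (k : Type u) [Field k]

/-- The formal Lie series in `x` and `y`: the series all of whose truncations lie in the Lie
subalgebra generated by `x` and `y` for the commutator bracket. -/
def lieSeries : Set (Aug (augFree k)) :=
  {a | ∀ N, proj (augFree k) N a ∈ LieSubalgebra.lieSpan k (Level (augFree k) N)
    {proj (augFree k) N (X k), proj (augFree k) N (Y k)}}

variable [CharZero k]

/-- The group `H(k) = exp L(k)` of exponentials of Lie series, as a subset of the group of series
with constant term `1`. -/
def hausdorff : Set (OneUnits (augFree k)) :=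
  {u | ∃ a ∈ lieSeries k, ((u : (NCSeries k)ˣ) : NCSeries k) = cexp a}

variable {k}

/-- The defining conditions on a pair `(λ, f)` of the Grothendieck-Teichmüller group `GT(k)`. -/
structure IsGT (g : Pair k) : Prop where
  /-- `f` is the exponential of a Lie series. -/
  mem_hausdorff : g.ser ∈ hausdorff k
  /-- `f(u, v) = f(v, u)⁻¹`. -/
  antisymm : ∀ u ∈ hausdorff k, ∀ v ∈ hausdorff k,
    groupEval g.ser u v = (groupEval g.ser v u)⁻¹
  /-- The hexagon equation `f(w, u) wᵐ f(v, w) vᵐ f(u, v) uᵐ = 1` for `u v w = 1`, where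
  `m = (λ - 1) / 2`. -/
  hexagon : ∀ u ∈ hausdorff k, ∀ v ∈ hausdorff k, ∀ w ∈ hausdorff k, u * v * w = 1 →
    ∀ m : k, m = ((g.scal : k) - 1) / 2 →
    ((groupEval g.ser w u : (NCSeries k)ˣ) : NCSeries k) * cpow w m *
      ((groupEval g.ser v w : (NCSeries k)ˣ) : NCSeries k) * cpow v m *
      ((groupEval g.ser u v : (NCSeries k)ˣ) : NCSeries k) * cpow u m = 1
  /-- The pentagon equation in `P₄(k)`. -/
  pentagon :
    groupEval g.ser (grp k ξ₁₂) (grp k (ξ₂₃ * ξ₂₄)) *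
        groupEval g.ser (grp k (ξ₁₃ * ξ₂₃)) (grp k ξ₃₄) =
      groupEval g.ser (grp k ξ₂₃) (grp k ξ₃₄) *
        groupEval g.ser (grp k (ξ₁₂ * ξ₁₃)) (grp k (ξ₂₄ * ξ₃₄)) *
        groupEval g.ser (grp k ξ₁₂) (grp k ξ₂₃)

variable (k) in
/-- The `k`-prounipotent Grothendieck-Teichmüller group `GT(k)` of the pairs `(λ, f)` with the
conditions `IsGT`. By a theorem of Drinfeld these pairs are stable under the group law and under
inversion, so that the subgroup which they generate consists of these pairs only. -/
def GTGroup : Subgroup (Pair k) := Subgroup.closure {g | IsGT g}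

lemma GTGroup_eq (G : Subgroup (Pair k)) (hG : ∀ g, g ∈ G ↔ IsGT g) : GTGroup k = G := by
  rw [GTGroup, show {g : Pair k | IsGT g} = (G : Set (Pair k)) from Set.ext fun g => (hG g).symm,
    Subgroup.closure_eq]

/-- The projection `GT(k) → kˣ`, `(λ, f) ↦ λ`. -/
def projGT : GTGroup k →* kˣ where
  toFun g := (g : Pair k).scal
  map_one' := rfl
  map_mul' _ _ := rfl

variable (k) in
/-- `GT₁(k)`, the kernel of `GT(k) → kˣ`. -/
def GT₁ : Subgroup (GTGroup k) := projGT.ker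

end GT

section Cohomology

variable {G : Type u} [Group G] {M : Type v} [CommGroup M]

/-- The group of `1`-cocycles `c(gh) = (c(g) · h) c(h)` of a group `G` in an abelian group `M`
(written multiplicatively) with a right action of `G` by automorphisms, given as an action of
the opposite group. -/
def Z1 (ρ : Gᵐᵒᵖ →* MulAut M) : Subgroup (G → M) where
  carrier := {c | ∀ g h, c (g * h) = ρ (MulOpposite.op h) (c g) * c h}
  one_mem' g h := by simp
  mul_mem' ha hb g h := by
    simp only [Pi.mul_apply, ha g h, hb g h, map_mul]; exact mul_mul_mul_comm _ _ _ _
  inv_mem' ha g h := by simp only [Pi.inv_apply, ha g h, map_inv, mul_inv]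

/-- The coboundaries `g ↦ (m · g) m⁻¹`. -/
def B1 (ρ : Gᵐᵒᵖ →* MulAut M) : Subgroup (Z1 ρ) where
  carrier := {c | ∃ m : M, ∀ g, (c : G → M) g = ρ (MulOpposite.op g) m * m⁻¹}
  one_mem' := ⟨1, fun g => by simp⟩
  mul_mem' := by
    rintro a b ⟨m, hm⟩ ⟨n, hn⟩
    refine ⟨m * n, fun g => ?_⟩
    simp only [Subgroup.coe_mul, Pi.mul_apply, hm g, hn g, map_mul, mul_inv]
    exact mul_mul_mul_comm _ _ _ _
  inv_mem' := by
    rintro a ⟨m, hm⟩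
    exact ⟨m⁻¹, fun g => by simp [hm g, mul_comm]⟩

/-- The first cohomology group `H¹(G, M)`. -/
abbrev H1 (ρ : Gᵐᵒᵖ →* MulAut M) : Type (max u v) := Z1 ρ ⧸ B1 ρ

/-- The restriction `H¹(G, M) → H¹(N, M) = Hom(N, M)` to a subgroup `N` which acts trivially on
`M`; it sends the class of a cocycle to the restriction of this cocycle to `N`. -/
def resHom (ρ : Gᵐᵒᵖ →* MulAut M) (N : Subgroup G)
    (hN : ∀ n ∈ N, ρ (MulOpposite.op n) = 1) : H1 ρ →* (N →* M) :=
  QuotientGroup.lift (B1 ρ)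
    { toFun := fun c => MonoidHom.mk' (fun n : N => (c : G → M) n) fun a b => by
        have := c.2 (a : G) (b : G)
        rwa [hN b b.2] at this
      map_one' := rfl
      map_mul' := fun _ _ => rfl }
    (by
      rintro c ⟨m, hm⟩
      ext n
      change (c : G → M) n = 1
      rw [hm, hN n n.2]; simp)

end Cohomology

section Coefficients

variable (k : Type u) [Field k]

/-- `A₁ = 1 + h k⟦h⟧`, as a group of units of the ring `A = k⟦h⟧`. -/
def A₁ : Subgroup (PowerSeries k)ˣ :=
  (Units.map (PowerSeries.constantCoeff (R := k) : PowerSeries k →* k)).ker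

variable {k}

lemma mem_A₁ {f : (PowerSeries k)ˣ} :
    f ∈ A₁ k ↔ PowerSeries.constantCoeff (f : PowerSeries k) = 1 := by
  simp [A₁, MonoidHom.mem_ker, Units.ext_iff]

/-- The endomorphism `f(h) ↦ f(α h)` of `A₁`. -/
def rescaleHom (α : k) : A₁ k →* A₁ k :=
  ((Units.map (PowerSeries.rescale α : PowerSeries k →* PowerSeries k)).comp
    (A₁ k).subtype).codRestrict (A₁ k) fun f => by
      have hf := mem_A₁.1 f.2
      rw [mem_A₁]
      rw [← PowerSeries.coeff_zero_eq_constantCoeff_apply] at hf ⊢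
      exact (PowerSeries.coeff_rescale _ _ _).trans (by rw [pow_zero, one_mul, ← hf]; rfl)

lemma coe_rescaleHom (α : k) (f : A₁ k) :
    ((rescaleHom α f : (PowerSeries k)ˣ) : PowerSeries k) =
      PowerSeries.rescale α ((f : (PowerSeries k)ˣ) : PowerSeries k) := rfl

/-- The automorphism `f(h) ↦ f(α h)` of `A₁` for `α ∈ kˣ`. -/
def rescaleAut (α : kˣ) : MulAut (A₁ k) :=
  MonoidHom.toMulEquiv (rescaleHom (α : k)) (rescaleHom ((α⁻¹ : kˣ) : k))
    (by
      ext f : 3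
      simp [coe_rescaleHom, PowerSeries.rescale_rescale])
    (by
      ext f : 3
      simp [coe_rescaleHom, PowerSeries.rescale_rescale])

variable (k) in
/-- The right action `(f · α)(h) = f(α h)` of `kˣ` on `A₁`. -/
def rescaleAction : (kˣ)ᵐᵒᵖ →* MulAut (A₁ k) where
  toFun α := rescaleAut α.unop
  map_one' := by
    ext f : 3
    change PowerSeries.rescale ((1 : kˣ) : k) ((f : (PowerSeries k)ˣ) : PowerSeries k) = _
    simp
  map_mul' α β := by
    ext f : 3
    change PowerSeries.rescale ((β.unop * α.unop : kˣ) : k) ((f : (PowerSeries k)ˣ) : _) =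
      PowerSeries.rescale (α.unop : k) (PowerSeries.rescale (β.unop : k) (f : (PowerSeries k)ˣ))
    rw [PowerSeries.rescale_rescale, Units.val_mul, mul_comm]

/-- The automorphism `x ↦ α ^ m x` of the additive group of `k`. -/
def powAut (m : ℕ) (α : kˣ) : MulAut (Multiplicative k) :=
  AddEquiv.toMultiplicative (DistribMulAction.toAddEquiv k (α ^ m))

variable (k) in
/-- The `kˣ`-module `k_m`: the additive group of `k` (written multiplicatively) with the action
`(α, x) ↦ α ^ m x`. -/
def powAction (m : ℕ) : (kˣ)ᵐᵒᵖ →* MulAut (Multiplicative k) where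
  toFun α := powAut m α.unop
  map_one' := by
    ext x
    change ((1 : kˣ) ^ m) • Multiplicative.toAdd x = Multiplicative.toAdd x
    simp
  map_mul' α β := by
    ext x
    change ((β.unop * α.unop : kˣ) ^ m) • Multiplicative.toAdd x =
      (α.unop ^ m) • (β.unop ^ m) • Multiplicative.toAdd x
    rw [smul_smul, mul_pow, mul_comm]

variable [CharZero k]

variable (k) in
/-- The right action of `GT(k)` on `A₁` through the projection `GT(k) → kˣ`. -/
def actionGT : (GTGroup k)ᵐᵒᵖ →* MulAut (A₁ k) :=
  (rescaleAction k).comp projGT.op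

lemma actionGT_GT₁ (g : GTGroup k) (hg : g ∈ GT₁ k) : actionGT k (MulOpposite.op g) = 1 := by
  have h : projGT g = 1 := hg
  change rescaleAction k (MulOpposite.op (projGT g)) = 1
  rw [h, MulOpposite.op_one, map_one]

variable (k) in
/-- The restriction map `H¹(GT(k), A₁) → Hom(GT₁(k), A₁)`. -/
def restriction : H1 (actionGT k) →* (GT₁ k →* A₁ k) :=
  resHom (actionGT k) (GT₁ k) actionGT_GT₁

end Coefficients

end GrothendieckTeichmuller

end

namespace GrothendieckTeichmuller

/-! ### Cocycles twisted by a character of an abstract group -/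

section TwistedCocycles

variable {k : Type*} [Field k] {G : Type*} [Group G]

/-! The argument is inflation-restriction combined with the filtration of $A_1$ by powers of $h$,
and it sees $GT(k)$ only through the character $\chi : GT(k)\to k^\times$. A class in the kernel of
restriction is represented by a cocycle $c$ that is trivial on $\ker\chi$. The successive quotients
of the filtration are the modules $k_m$, $m\ge 1$, with the group acting through $\chi^m$. So it
suffices to kill, degree by degree, additive cocycles with values in $k_m$ that vanish on
$\ker\chi$.

`exists_eq_sub_mul_of_cocycle` does this for an arbitrary group and character. If some
$\chi(g_0)^m\ne 1$, then $b(gg_0)=b(g_0g)$ because the two arguments differ by a commutator, and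
expanding both sides gives $b(g)=(\chi(g)^m-1)\,b(g_0)/(\chi(g_0)^m-1)$. If $\chi^m=1$, then $b$ is
additive and $m\,b(g)=b(g^m)=0$, so $b=0$ in characteristic $0$. Hence no description of the image
of $\chi$ is needed. For $\chi$ the identity of $k^\times$ this is the vanishing of
$H^1(k^\times,k_m)$.

`exists_rescale_eq_mul` assembles the degrees: it solves $a(\chi(g)h)=c(g)\,a$ for all $g$ at once,
one coefficient of $a$ at a time. In degree $n$ the equation reads
$(\chi(g)^n-1)\,a_n=\sum_{j<n}c(g)_{n-j}\,a_j$. Once the lower degrees are solved, the right side is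
a cocycle in $g$ for $\chi^n$, so a common solution $a_n$ exists. Since the coefficients are
constructed outright, no continuity or completeness argument is needed. -/

/-- A cocycle with values in the `m`-th power, `m ≥ 1`, of a character `χ` which vanishes on the
kernel of `χ` is a coboundary. -/
lemma exists_eq_sub_mul_of_cocycle [CharZero k] (χ : G →* kˣ) {m : ℕ} (hm : m ≠ 0) (b : G → k)
    (hb : ∀ g h, b (g * h) = (χ h : k) ^ m * b g + b h) (hker : ∀ g, χ g = 1 → b g = 0) :
    ∃ x, ∀ g, b g = ((χ g : k) ^ m - 1) * x := by
  by_cases H : ∃ g₀, (χ g₀ : k) ^ m ≠ 1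
  · obtain ⟨g₀, h₀⟩ := H
    have h₁ := sub_ne_zero.2 h₀
    refine ⟨b g₀ / ((χ g₀ : k) ^ m - 1), fun g => ?_⟩
    -- The commutator `g * g₀ * (g₀ * g)⁻¹` lies in the kernel of `χ`, where `b` vanishes, so
    -- multiplying by it on the left does not change `b`.
    have hcomm : b (g * g₀) = b (g₀ * g) := by
      have h := hb (g * g₀ * (g₀ * g)⁻¹) (g₀ * g)
      rwa [inv_mul_cancel_right, hker (g * g₀ * (g₀ * g)⁻¹) (by
        rw [map_mul, map_inv, map_mul, map_mul, mul_comm (χ g₀), mul_inv_cancel]), mul_zero,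
        zero_add] at h
    rw [hb, hb] at hcomm
    field_simp
    linear_combination hcomm
  -- Here `χ ^ m` is trivial, so `b` is a homomorphism to the torsion-free group `k`, and it kills
  -- every `g ^ m` because `χ (g ^ m) = 1`.
  · push Not at H
    refine ⟨0, fun g => ?_⟩
    have hpow : ∀ n : ℕ, b (g ^ n) = n * b g := by
      intro n
      induction n with
      | zero => simpa using hker 1 (map_one χ)
      | succ n ih => rw [pow_succ, hb, ih, H]; push_cast; ring
    have hχ : χ (g ^ m) = 1 := by
      rw [map_pow]; exact Units.ext (by simpa using H g)
    have h := hpow m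
    rw [hker _ hχ] at h
    simpa [hm] using h.symm

/-! ### Multiplicative cocycles of power series -/

/-- The coefficients of a series `a` with constant term `1` and `a(χ(g) h) = c(g) a` for all `g`,
chosen one after the other. -/
noncomputable def trivializingCoeff (χ : G →* kˣ) (c : G → PowerSeries k) : ℕ → k
  | 0 => 1
  -- The common solution `x` exists only because the earlier coefficients already solve their
  -- equations. `Classical.epsilon` postpones that proof to the induction below. Summing over `Fin
  -- (m + 1)` keeps the bound on `j` available for the termination of the recursion.
  | m + 1 => Classical.epsilon fun x => ∀ g,
      ∑ j : Fin (m + 1), PowerSeries.coeff (m + 1 - j) (c g) * trivializingCoeff χ c j =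
        ((χ g : k) ^ (m + 1) - 1) * x

/-- Isolates the one term that involves the top coefficient of `a`. The rest depends only on lower
coefficients, which is what makes the recursion triangular. -/
lemma coeff_mul_of_constantCoeff_eq_one {f a : PowerSeries k}
    (hf : PowerSeries.constantCoeff f = 1) (n : ℕ) :
    PowerSeries.coeff n (f * a) =
      (∑ j ∈ Finset.range n, PowerSeries.coeff (n - j) f * PowerSeries.coeff j a) +
        PowerSeries.coeff n a := by
  rw [mul_comm, PowerSeries.coeff_mul, Finset.Nat.sum_antidiagonal_eq_sum_range_succ
    (fun i j => PowerSeries.coeff i a * PowerSeries.coeff j f), Finset.sum_range_succ]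
  simp [hf, mul_comm]

/-- A cocycle of power series with constant term `1` which is trivial on the kernel of `χ` is a
coboundary. -/
lemma exists_rescale_eq_mul [CharZero k] (χ : G →* kˣ) (c : G → PowerSeries k)
    (hc₀ : ∀ g, PowerSeries.constantCoeff (c g) = 1)
    (hc : ∀ g h, c (g * h) = PowerSeries.rescale (χ h : k) (c g) * c h)
    (hker : ∀ g, χ g = 1 → c g = 1) :
    ∃ a : PowerSeries k, PowerSeries.constantCoeff a = 1 ∧
      ∀ g, PowerSeries.rescale (χ g : k) a = c g * a := by
  refine ⟨PowerSeries.mk (trivializingCoeff χ c), by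
    rw [← PowerSeries.coeff_zero_eq_constantCoeff_apply, PowerSeries.coeff_mk]
    simp [trivializingCoeff], fun g => PowerSeries.ext fun n => ?_⟩
  induction n using Nat.strong_induction_on generalizing g with
  | _ n ih =>
  cases n with
  | zero => simp [hc₀]
  | succ m =>
  set t := PowerSeries.mk (trivializingCoeff χ c) with ht
  -- the truncation of `t` below degree `m + 1`
  set s : PowerSeries k := PowerSeries.mk fun j => if j < m + 1 then trivializingCoeff χ c j else 0
    with hs
  have hst : ∀ j < m + 1, PowerSeries.coeff j s = PowerSeries.coeff j t := fun j hj => by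
    rw [hs, ht, PowerSeries.coeff_mk, PowerSeries.coeff_mk, if_pos hj]
  have hsm : PowerSeries.coeff (m + 1) s = 0 := by simp [hs]
  -- The obstruction in degree `m + 1`. Truncating `t` removes its still unknown coefficient of that
  -- degree, so `b` depends only on coefficients already covered by the induction hypothesis.
  set b : G → k := fun g => PowerSeries.coeff (m + 1) (c g * s) with hb
  -- Below degree `m + 1` the truncation `s` may replace `t`, so this is the induction hypothesis.
  have hlow : ∀ g, ∀ n < m + 1,
      PowerSeries.coeff n (c g * s) = PowerSeries.coeff n (PowerSeries.rescale (χ g : k) s) := by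
    intro g n hn
    rw [PowerSeries.coeff_rescale, hst n hn, ← PowerSeries.coeff_rescale, ih n hn g,
      coeff_mul_of_constantCoeff_eq_one (hc₀ g), coeff_mul_of_constantCoeff_eq_one (hc₀ g),
      hst n hn]
    congr 1
    refine Finset.sum_congr rfl fun j hj => ?_
    rw [hst j ((Finset.mem_range.1 hj).trans hn)]
  -- Write `c (g * h) * s` as `rescale (c g) * (c h * s)`, and `rescale (c g * s)` as `rescale (c g)
  -- * rescale s`. By `hlow` the second factors agree below degree `m + 1`. As `rescale (c g)` has
  -- constant term `1`, the two products differ in degree `m + 1` only by the top coefficients of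
  -- the second factors, which are `b h` and `0`.
  have hcoc : ∀ g h, b (g * h) = (χ h : k) ^ (m + 1) * b g + b h := by
    intro g h
    have hr : PowerSeries.constantCoeff (PowerSeries.rescale (χ h : k) (c g)) = 1 := by
      rw [← PowerSeries.coeff_zero_eq_constantCoeff_apply, PowerSeries.coeff_rescale]
      simp [hc₀]
    simp only [hb]
    rw [← PowerSeries.coeff_rescale, map_mul (PowerSeries.rescale _), hc, mul_assoc,
      coeff_mul_of_constantCoeff_eq_one hr, coeff_mul_of_constantCoeff_eq_one hr,
      PowerSeries.coeff_rescale s, hsm, mul_zero, add_zero]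
    congr 1
    refine Finset.sum_congr rfl fun j hj => ?_
    rw [hlow h j (Finset.mem_range.1 hj)]
  have hsum : ∀ g, b g = ∑ j ∈ Finset.range (m + 1),
      PowerSeries.coeff (m + 1 - j) (c g) * PowerSeries.coeff j t := by
    intro g
    simp only [hb]
    rw [coeff_mul_of_constantCoeff_eq_one (hc₀ g), hsm, add_zero]
    exact Finset.sum_congr rfl fun j hj => by rw [hst j (Finset.mem_range.1 hj)]
  have hex := exists_eq_sub_mul_of_cocycle χ (Nat.succ_ne_zero m) b hcoc fun g hg => by
    simp only [hb]
    rw [hker g hg, one_mul, hsm]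
  -- The value chosen by `Classical.epsilon` is now known to be a solution, since `hex` supplies one
  -- valid for all `g` simultaneously.
  have hsol : b g = ((χ g : k) ^ (m + 1) - 1) * PowerSeries.coeff (m + 1) t := by
    have hfin : ∀ g, b g = ∑ j : Fin (m + 1),
        PowerSeries.coeff (m + 1 - j) (c g) * trivializingCoeff χ c j := fun g => by
      rw [hsum, Finset.sum_range]
      simp only [ht, PowerSeries.coeff_mk]
    simp only [hfin] at hex ⊢
    rw [ht, PowerSeries.coeff_mk, trivializingCoeff]
    exact Classical.epsilon_spec hex g
  rw [PowerSeries.coeff_rescale, coeff_mul_of_constantCoeff_eq_one (hc₀ g), ← hsum, hsol]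
  ring

end TwistedCocycles

/-! ### Application to $GT(k)$ and to the modules $k_m$ -/

lemma restriction_injective {k : Type*} [Field k] [CharZero k] :
    Function.Injective (restriction k) := by
  rw [injective_iff_map_eq_one]
  intro z
  induction z using QuotientGroup.induction_on with
  | H c =>
  intro hz
  rw [QuotientGroup.eq_one_iff]
  -- Coboundaries vanish on $GT_1(k)$, so a class with trivial restriction gives an actual vanishing
  -- of the representative `c` there, with no correction of `c`.
  have hker : ∀ g, projGT g = 1 → (c : GTGroup k → A₁ k) g = 1 := fun g hg =>
    DFunLike.congr_fun hz (⟨g, hg⟩ : GT₁ k)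
  obtain ⟨a, ha₀, ha⟩ := exists_rescale_eq_mul (projGT (k := k))
    (fun g => (((c : GTGroup k → A₁ k) g : (PowerSeries k)ˣ) : PowerSeries k))
    (fun g => mem_A₁.1 ((c : GTGroup k → A₁ k) g).2)
    (fun g h => congrArg (fun f : A₁ k => ((f : (PowerSeries k)ˣ) : PowerSeries k)) (c.2 g h))
    (fun g hg => by rw [hker g hg]; rfl)
  -- Constant term `1` makes `a` invertible, so it is an element of $A_1$ and the equation `a(χ(g)
  -- h) = c(g) a` becomes the coboundary formula.
  obtain ⟨u, rfl⟩ : IsUnit a := PowerSeries.isUnit_iff_constantCoeff.2 (by simp [ha₀])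
  refine ⟨⟨u, mem_A₁.2 ha₀⟩, fun g => ?_⟩
  rw [eq_mul_inv_iff_mul_eq]
  exact Subtype.ext (Units.ext (ha g).symm)

/-- The additive lemma for the identity character, whose kernel is trivial: the condition on the
kernel reduces to `c 1 = 0`. -/
lemma subsingleton_H1_powAction {k : Type*} [Field k] [CharZero k] {m : ℕ} (hm : m ≠ 0) :
    Subsingleton (H1 (powAction k m)) := by
  refine ⟨fun z w => ?_⟩
  suffices h : ∀ z : H1 (powAction k m), z = 1 from (h z).trans (h w).symm
  intro z
  induction z using QuotientGroup.induction_on with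
  | H c =>
  rw [QuotientGroup.eq_one_iff]
  have hc : ∀ g h : kˣ, Multiplicative.toAdd ((c : kˣ → Multiplicative k) (g * h)) =
      (h : k) ^ m * Multiplicative.toAdd ((c : kˣ → Multiplicative k) g) +
        Multiplicative.toAdd ((c : kˣ → Multiplicative k) h) := fun g h => by
    rw [← Units.val_pow_eq_pow_val]
    exact congrArg Multiplicative.toAdd (c.2 g h)
  obtain ⟨x, hx⟩ := exists_eq_sub_mul_of_cocycle (MonoidHom.id kˣ) hm _ hc fun g hg => by
    obtain rfl : g = 1 := hg
    -- The cocycle rule at `(1, 1)` reads `c 1 = c 1 + c 1`.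
    have h := hc 1 1
    rw [mul_one, Units.val_one, one_pow, one_mul] at h
    exact left_eq_add.1 h
  refine ⟨Multiplicative.ofAdd x, fun g => Multiplicative.toAdd.injective ?_⟩
  refine (hx g).trans ?_
  change _ = (g ^ m) • x + -x
  rw [Units.smul_def, Units.val_pow_eq_pow_val, smul_eq_mul, MonoidHom.id_apply]
  ring

end GrothendieckTeichmuller

open GrothendieckTeichmuller in
theorem mainTheorem7 {k : Type*} [Field k] [CharZero k] :
    Function.Injective (restriction k) ∧
      ∀ m : ℕ, 1 ≤ m → Subsingleton (H1 (powAction k m)) :=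
  ⟨restriction_injective, fun _ hm => subsingleton_H1_powAction (Nat.one_le_iff_ne_zero.1 hm)⟩
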